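/- For $G>0$ let $g_G(x)=G^{1/2}e^{-\pi G x^2}$ ($x\in\mathbb{R}$) and let $$T(G)=\{\,g_G*\mu:\ \mu \text{ a positive finite Borel measure on } \mathbb{R} \text{ with non-zero mass}\,\}.$$ For $c_1,c_2\in(0,1)$ and $\sigma_1,\sigma_2>0$ let $\mathrm{PL}(\mathbf{c},(\sigma_1^{-1},\sigma_2^{-1}))\in[0,\infty]$ be the sharp (i.e. smallest) constant $C$ in the inequality $$\bigg(\int_{\mathbb{R}} f_1\bigg)^{c_1}\bigg(\int_{\mathbb{R}} f_2\bigg)^{c_2}\le C\int_{\mathbb{R}}\ \operatorname*{ess\,sup}_{\substack{x_1,x_2\in\mathbb{R}:\\ x=c_1x_1+c_2x_2}} f_1(x_1)^{c_1}f_2(x_2)^{c_2}\,dx$$ over all $(f_1,f_2)\in T(\sigma_1^{-1})\times T(\sigma_2^{-1})$, and let $$\Phi_{\mathbf{c}}(a_1,a_2)=a_1^{c_1}a_2^{c_2}\Big(\frac{c_1}{a_1}+\frac{c_2}{a_2}\Big)\qquad(a_1,a_2>0).$$ Let $c_1,c_2\in(0,1)$ satisfy $c_1+c_2<1$, and let $\sigma_1,\sigma_2>0$.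 Then $$\mathrm{PL}(\mathbf{c},(\sigma_1^{-1},\sigma_2^{-1}))=\Phi_{\mathbf{c}}(\sigma_1^{-1},\sigma_2^{-1})^{-1/2}=\bigg(\frac{\sigma_1^{c_1}\sigma_2^{c_2}}{c_1\sigma_1+c_2\sigma_2}\bigg)^{1/2}$$ if and only if $$c_1\sigma_1+c_2\sigma_2\le\min\{\sigma_1,\sigma_2\}.$$ (The second equality in the display holds unconditionally.) -/

import Mathlib

open MeasureTheory

noncomputable section

namespace RegPL

/-- The normalized centred gaussian `g_G(x) = G^{1/2} e^{-π G x²}` on the real line. -/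
def gauss (G x : ℝ) : ℝ :=
  Real.sqrt G * Real.exp (-Real.pi * (G * x ^ 2))

/-- The class `T(G)` of type `G` functions on the real line: all convolutions `g_G ∗ μ` with `μ`
a positive finite Borel measure of non-zero mass. -/
def TypeClass (G : ℝ) : Set (ℝ → ℝ) :=
  {f | ∃ μ : Measure ℝ, IsFiniteMeasure μ ∧ μ ≠ 0 ∧ f = fun x => ∫ y, gauss G (x - y) ∂μ}

/-- The essential supremum of `f₁(x₁)^{c₁} f₂(x₂)^{c₂}` over the line
`{(x₁, x₂) : x = c₁ x₁ + c₂ x₂}` equipped with its one-dimensional Lebesgue measure.  For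
`c₂ ≠ 0` the line is parametrized affinely by `x₁ = t`, `x₂ = (x - c₁ t) / c₂`, and the null sets
do not depend on the choice of an affine parametrization. -/
def supConv (c₁ c₂ : ℝ) (f₁ f₂ : ℝ → ℝ) (x : ℝ) : ENNReal :=
  essSup (fun t : ℝ => ENNReal.ofReal (f₁ t ^ c₁ * f₂ ((x - c₁ * t) / c₂) ^ c₂)) volume

/-- `C` is an admissible constant in the Prékopa–Leindler inequality for inputs in
`T(G₁) × T(G₂)`. -/
def IsPLConstant (c₁ c₂ G₁ G₂ : ℝ) (C : ENNReal) : Prop :=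
  ∀ f₁ ∈ TypeClass G₁, ∀ f₂ ∈ TypeClass G₂,
    (∫⁻ x, ENNReal.ofReal (f₁ x)) ^ c₁ * (∫⁻ x, ENNReal.ofReal (f₂ x)) ^ c₂
      ≤ C * ∫⁻ x, supConv c₁ c₂ f₁ f₂ x

/-- The sharp (smallest) constant `PL(c, (G₁, G₂)) ∈ [0, ∞]`. -/
def PL (c₁ c₂ G₁ G₂ : ℝ) : ENNReal :=
  sInf {C : ENNReal | IsPLConstant c₁ c₂ G₁ G₂ C}

/-- `Φ_c(a₁, a₂) = a₁^{c₁} a₂^{c₂} (c₁ / a₁ + c₂ / a₂)`. -/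
def Phi (c₁ c₂ a₁ a₂ : ℝ) : ℝ :=
  a₁ ^ c₁ * a₂ ^ c₂ * (c₁ / a₁ + c₂ / a₂)

end RegPL

end

noncomputable section

namespace RegPL

open Filter Topology

/-! Put `S = c₁σ₁ + c₂σ₂`. Sufficiency is mass transport. The gaussian isoperimetric profile is
concave, so by Jensen (`mixture_le`) the monotone map from `m` times the centred gaussian to a type
`G` function of mass `m` has derivative at least 1. Changing variables along `c₁T₁(σ₁s) + c₂T₂(σ₂s)`
leaves a pointwise inequality between `T₁'` and `T₂'`. It is AM-GM with weights `cᵢσᵢ/S`; as `S ≤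
σᵢ`, these weights are at least `cᵢ`, and derivatives at least 1 allow the exponents to be raised.
Necessity: gaussians of variances `τᵢ ≥ σᵢ` are admissible and give `gaussConst c₁ c₂ τ₁ τ₂ ≤ PL`.
Equality thus makes `(σ₁, σ₂)` a maximum over larger variances, and the one-sided first-order
conditions are `S ≤ σ₁` and `S ≤ σ₂`. -/

lemma gauss_pos {G : ℝ} (hG : 0 < G) (x : ℝ) : 0 < gauss G x :=
  mul_pos (Real.sqrt_pos.2 hG) (Real.exp_pos _)

lemma gauss_le {G : ℝ} (hG : 0 < G) (x : ℝ) : gauss G x ≤ √G := by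
  unfold gauss
  refine mul_le_of_le_one_right (Real.sqrt_nonneg _) (Real.exp_le_one_iff.2 ?_)
  have := mul_nonneg Real.pi_pos.le (mul_nonneg hG.le (sq_nonneg x))
  linarith

lemma continuous_gauss (G : ℝ) : Continuous (gauss G) := by
  unfold gauss; fun_prop

lemma gauss_eq (G : ℝ) : gauss G = fun x => √G * Real.exp (-(Real.pi * G) * x ^ 2) := by
  funext x
  unfold gauss
  congr 2
  ring

lemma hasDerivAt_gauss (G x : ℝ) :
    HasDerivAt (gauss G) (-(2 * Real.pi * G * x) * gauss G x) x := by
  have h : HasDerivAt (fun x : ℝ => -Real.pi * (G * x ^ 2)) (-Real.pi * (G * (2 * x))) x := by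
    simpa using (((hasDerivAt_pow 2 x).const_mul G).const_mul (-Real.pi))
  refine ((h.exp).const_mul (√G)).congr_deriv ?_
  unfold gauss
  ring

lemma integrable_gauss {G : ℝ} (hG : 0 < G) : Integrable (gauss G) := by
  rw [gauss_eq]
  exact (integrable_exp_neg_mul_sq (mul_pos Real.pi_pos hG)).const_mul _

lemma sqrt_mul_sqrt_pi_div {G : ℝ} (hG : 0 < G) : √G * √(Real.pi / (Real.pi * G)) = 1 := by
  have hπ := Real.pi_pos
  rw [← Real.sqrt_mul hG.le, show G * (Real.pi / (Real.pi * G)) = 1 by field_simp, Real.sqrt_one]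

lemma integral_gauss {G : ℝ} (hG : 0 < G) : ∫ x, gauss G x = 1 := by
  rw [gauss_eq, integral_const_mul, integral_gaussian, sqrt_mul_sqrt_pi_div hG]

lemma integral_Ioi_gauss {G : ℝ} (hG : 0 < G) : ∫ x in Set.Ioi 0, gauss G x = 1 / 2 := by
  rw [gauss_eq, integral_const_mul, integral_gaussian_Ioi, ← mul_div_assoc,
    sqrt_mul_sqrt_pi_div hG]

lemma lintegral_gauss {G : ℝ} (hG : 0 < G) : ∫⁻ x, ENNReal.ofReal (gauss G x) = 1 := by
  rw [← ofReal_integral_eq_lintegral_ofReal (integrable_gauss hG)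
    (Eventually.of_forall fun x => (gauss_pos hG x).le), integral_gauss hG, ENNReal.ofReal_one]

/-- The primitive of the gaussian vanishing at the origin. -/
def gaussPrim (G x : ℝ) : ℝ := ∫ t in (0 : ℝ)..x, gauss G t

lemma hasDerivAt_gaussPrim (G x : ℝ) : HasDerivAt (gaussPrim G) (gauss G x) x :=
  ((continuous_gauss G).integral_hasStrictDerivAt 0 x).hasDerivAt

lemma continuous_gaussPrim (G : ℝ) : Continuous (gaussPrim G) :=
  continuous_iff_continuousAt.2 fun x => (hasDerivAt_gaussPrim G x).continuousAt

lemma gaussPrim_strictMono {G : ℝ} (hG : 0 < G) : StrictMono (gaussPrim G) :=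
  strictMono_of_hasDerivAt_pos (hasDerivAt_gaussPrim G) (gauss_pos hG)

lemma gaussPrim_neg (G x : ℝ) : gaussPrim G (-x) = -gaussPrim G x := by
  have h : ∀ t, gauss G (-t) = gauss G t := fun t => by simp [gauss]
  have := intervalIntegral.integral_comp_neg (a := 0) (b := x) (gauss G)
  simp only [h, neg_zero] at this
  unfold gaussPrim
  rw [this, intervalIntegral.integral_symm]

lemma tendsto_gaussPrim_atTop {G : ℝ} (hG : 0 < G) :
    Tendsto (gaussPrim G) atTop (𝓝 (1 / 2)) := by
  rw [← integral_Ioi_gauss hG]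
  exact intervalIntegral_tendsto_integral_Ioi 0 (integrable_gauss hG).integrableOn tendsto_id

lemma tendsto_gaussPrim_atBot {G : ℝ} (hG : 0 < G) :
    Tendsto (gaussPrim G) atBot (𝓝 (-(1 / 2))) := by
  have h := ((tendsto_gaussPrim_atTop hG).comp tendsto_neg_atBot_atTop).neg
  refine h.congr fun x => ?_
  simp [gaussPrim_neg]

lemma abs_gaussPrim_lt {G : ℝ} (hG : 0 < G) (x : ℝ) : |gaussPrim G x| < 1 / 2 := by
  have hlt : ∀ y, gaussPrim G y < 1 / 2 := fun y =>
    (gaussPrim_strictMono hG (lt_add_one y)).trans_le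
      ((gaussPrim_strictMono hG).monotone.ge_of_tendsto (tendsto_gaussPrim_atTop hG) _)
  refine abs_lt.2 ⟨?_, hlt x⟩
  have := hlt (-x)
  rw [gaussPrim_neg] at this
  linarith

/-- Concavity of the gaussian isoperimetric profile, in tangent line form. -/
lemma gauss_le_tangent {G : ℝ} (hG : 0 < G) (x z : ℝ) :
    gauss G x ≤ gauss G z - 2 * Real.pi * G * z * (gaussPrim G x - gaussPrim G z) := by
  -- The profile `gauss ∘ gaussPrim⁻¹` has slope `-2πGz` at `gaussPrim G z`; subtracting that
  -- tangent gives a function increasing up to `z` and decreasing after it.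
  set φ : ℝ → ℝ := fun y => gauss G y + 2 * Real.pi * G * z * gaussPrim G y with hφ
  have hd : ∀ y, HasDerivAt φ (2 * Real.pi * G * gauss G y * (z - y)) y := fun y =>
    ((hasDerivAt_gauss G y).add ((hasDerivAt_gaussPrim G y).const_mul _)).congr_deriv (by ring)
  have hc : Continuous φ := continuous_iff_continuousAt.2 fun y => (hd y).continuousAt
  have hp : ∀ y, 0 ≤ 2 * Real.pi * G * gauss G y := fun y => by
    have := gauss_pos hG y
    have := Real.pi_pos
    positivity
  have key : φ x ≤ φ z := by
    rcases le_total x z with h | h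
    · refine monotoneOn_of_deriv_nonneg (convex_Iic z) hc.continuousOn
        (fun y _ => (hd y).differentiableAt.differentiableWithinAt) (fun y hy => ?_)
        (Set.mem_Iic.2 h) (Set.mem_Iic.2 le_rfl) h
      rw [interior_Iic, Set.mem_Iio] at hy
      rw [(hd y).deriv]
      exact mul_nonneg (hp y) (by linarith)
    · refine antitoneOn_of_deriv_nonpos (convex_Ici z) hc.continuousOn
        (fun y _ => (hd y).differentiableAt.differentiableWithinAt) (fun y hy => ?_)
        (Set.mem_Ici.2 le_rfl) (Set.mem_Ici.2 h) h
      rw [interior_Ici, Set.mem_Ioi] at hy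
      rw [(hd y).deriv]
      exact mul_nonpos_of_nonneg_of_nonpos (hp y) (by linarith)
  simp only [hφ] at key
  linarith

/-! ### Gaussian mixtures and their primitives -/

section Mixture

variable {G : ℝ} (μ : Measure ℝ) [IsFiniteMeasure μ]

lemma integrable_gauss_sub (hG : 0 < G) (x : ℝ) : Integrable (fun y => gauss G (x - y)) μ := by
  refine Integrable.of_bound (C := √G)
    ((continuous_gauss G).comp (continuous_const.sub continuous_id)).aestronglyMeasurable
    (Eventually.of_forall fun y => ?_)
  rw [Real.norm_eq_abs, abs_of_pos (gauss_pos hG _)]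
  exact gauss_le hG _

lemma integrable_gaussPrim_sub (hG : 0 < G) (x : ℝ) :
    Integrable (fun y => gaussPrim G (x - y)) μ := by
  refine Integrable.of_bound (C := 1 / 2)
    ((continuous_gaussPrim G).comp (continuous_const.sub continuous_id)).aestronglyMeasurable
    (Eventually.of_forall fun y => ?_)
  exact (abs_gaussPrim_lt hG _).le

lemma continuous_mixture (hG : 0 < G) : Continuous (fun x => ∫ y, gauss G (x - y) ∂μ) := by
  refine continuous_of_dominated (bound := fun _ => √G) (fun x => ?_) (fun x => ?_)
    (integrable_const _) (Eventually.of_forall fun y => ?_)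
  · exact (integrable_gauss_sub μ hG x).aestronglyMeasurable
  · refine Eventually.of_forall fun y => ?_
    rw [Real.norm_eq_abs, abs_of_pos (gauss_pos hG _)]
    exact gauss_le hG _
  · exact (continuous_gauss G).comp (continuous_id.sub continuous_const)

lemma mixture_pos (hG : 0 < G) (hμ : μ ≠ 0) (x : ℝ) : 0 < ∫ y, gauss G (x - y) ∂μ := by
  rw [integral_pos_iff_support_of_nonneg (fun y => (gauss_pos hG _).le)
    (integrable_gauss_sub μ hG x)]
  have : Function.support (fun y => gauss G (x - y)) = Set.univ :=
    Set.eq_univ_of_forall fun y => (gauss_pos hG _).ne'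
  rw [this]
  exact Measure.measure_univ_pos.2 hμ

lemma hasDerivAt_mixturePrim (hG : 0 < G) (x : ℝ) :
    HasDerivAt (fun x => ∫ y, gaussPrim G (x - y) ∂μ) (∫ y, gauss G (x - y) ∂μ) x := by
  refine (hasDerivAt_integral_of_dominated_loc_of_deriv_le (s := Set.univ)
    (F' := fun x y => gauss G (x - y)) (bound := fun _ => √G) univ_mem
    (Eventually.of_forall fun x => (integrable_gaussPrim_sub μ hG x).aestronglyMeasurable)
    (integrable_gaussPrim_sub μ hG x) (integrable_gauss_sub μ hG x).aestronglyMeasurable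
    (Eventually.of_forall fun y x _ => ?_) (integrable_const _)
    (Eventually.of_forall fun y x _ => ?_)).2
  · rw [Real.norm_eq_abs, abs_of_pos (gauss_pos hG _)]
    exact gauss_le hG _
  · exact (hasDerivAt_gaussPrim G (x - y)).comp_sub_const x y

lemma tendsto_mixturePrim {l : Filter ℝ} [l.IsCountablyGenerated] {a : ℝ} (hG : 0 < G)
    (h : ∀ y, Tendsto (fun x => gaussPrim G (x - y)) l (𝓝 a)) :
    Tendsto (fun x => ∫ y, gaussPrim G (x - y) ∂μ) l (𝓝 (μ.real Set.univ * a)) := by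
  have := tendsto_integral_filter_of_dominated_convergence (μ := μ) (l := l)
    (F := fun x y => gaussPrim G (x - y)) (f := fun _ => a) (fun _ => 1 / 2)
    (Eventually.of_forall fun x => (integrable_gaussPrim_sub μ hG x).aestronglyMeasurable)
    (Eventually.of_forall fun x => Eventually.of_forall fun y => (abs_gaussPrim_lt hG _).le)
    (integrable_const _) (Eventually.of_forall h)
  simpa using this

lemma exists_mixturePrim_eq (hG : 0 < G) (hμ : μ ≠ 0) (z : ℝ) :
    ∃ x, ∫ y, gaussPrim G (x - y) ∂μ = μ.real Set.univ * gaussPrim G z := by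
  have hm : 0 < μ.real Set.univ := by
    rw [measureReal_def]
    exact ENNReal.toReal_pos (Measure.measure_univ_pos.2 hμ).ne' (measure_ne_top _ _)
  have hz := abs_lt.1 (abs_gaussPrim_lt hG z)
  have ht := tendsto_mixturePrim μ (a := 1 / 2) hG fun y =>
    (tendsto_gaussPrim_atTop hG).comp (tendsto_atTop_add_const_right _ (-y) tendsto_id)
  have hb := tendsto_mixturePrim μ (a := -(1 / 2)) hG fun y =>
    (tendsto_gaussPrim_atBot hG).comp (tendsto_atBot_add_const_right _ (-y) tendsto_id)
  obtain ⟨u, hu⟩ := (ht.eventually_const_lt (mul_lt_mul_of_pos_left hz.2 hm)).exists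
  obtain ⟨v, hv⟩ := (hb.eventually_lt_const (mul_lt_mul_of_pos_left hz.1 hm)).exists
  exact mem_range_of_exists_le_of_exists_ge
    (continuous_iff_continuousAt.2 fun x => (hasDerivAt_mixturePrim μ hG x).continuousAt)
    ⟨v, hv.le⟩ ⟨u, hu.le⟩

/-- Jensen's inequality: when the tangent-line bound at `z` is integrated against `μ`, the choice of
`x` kills the linear term. -/
lemma mixture_le (hG : 0 < G) {x z : ℝ}
    (h : ∫ y, gaussPrim G (x - y) ∂μ = μ.real Set.univ * gaussPrim G z) :
    ∫ y, gauss G (x - y) ∂μ ≤ μ.real Set.univ * gauss G z := by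
  have hi : Integrable (fun y => 2 * Real.pi * G * z * (gaussPrim G (x - y) - gaussPrim G z)) μ :=
    ((integrable_gaussPrim_sub μ hG x).sub (integrable_const _)).const_mul _
  refine (integral_mono (integrable_gauss_sub μ hG x) ((integrable_const _).sub hi)
    fun y => gauss_le_tangent hG (x - y) z).trans (le_of_eq ?_)
  simp only [Pi.sub_apply]
  rw [integral_sub (integrable_const _) hi, integral_const_mul,
    integral_sub (integrable_gaussPrim_sub μ hG x) (integrable_const _), h]
  simp

lemma lintegral_mixture (hG : 0 < G) :
    ∫⁻ x, ENNReal.ofReal (∫ y, gauss G (x - y) ∂μ) = ENNReal.ofReal (μ.real Set.univ) := by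
  have hcont : Continuous fun p : ℝ × ℝ => ENNReal.ofReal (gauss G (p.1 - p.2)) :=
    ENNReal.continuous_ofReal.comp ((continuous_gauss G).comp (continuous_fst.sub continuous_snd))
  calc ∫⁻ x, ENNReal.ofReal (∫ y, gauss G (x - y) ∂μ)
      = ∫⁻ x, ∫⁻ y, ENNReal.ofReal (gauss G (x - y)) ∂μ := by
        refine lintegral_congr fun x => ?_
        exact ofReal_integral_eq_lintegral_ofReal (integrable_gauss_sub μ hG x)
          (Eventually.of_forall fun y => (gauss_pos hG _).le)
    _ = ∫⁻ y, (∫⁻ x, ENNReal.ofReal (gauss G (x - y))) ∂μ :=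
        lintegral_lintegral_swap hcont.measurable.aemeasurable
    _ = ∫⁻ _, 1 ∂μ := by
        refine lintegral_congr fun y => ?_
        rw [lintegral_sub_right_eq_self (fun x => ENNReal.ofReal (gauss G x)) y,
          lintegral_gauss hG]
    _ = ENNReal.ofReal (μ.real Set.univ) := by simp [measureReal_def]

end Mixture

/-- If `F` and `E` are primitives of `f > 0` and `g`, and `F` takes all values of `E`, then the
monotone map `T = F⁻¹ ∘ E` satisfies the transport equation `f (T z) * T' z = g z`. -/
lemma exists_transport {F E f g : ℝ → ℝ} (hF : ∀ x, HasDerivAt F (f x) x) (hf : ∀ x, 0 < f x)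
    (hfc : Continuous f) (hE : ∀ z, HasDerivAt E (g z) z) (hr : ∀ z, ∃ x, F x = E z) :
    ∃ T : ℝ → ℝ, ∀ z, F (T z) = E z ∧ HasDerivAt T (g z / f (T z)) z := by
  -- `F` need not be onto, so its inverse lives on its open range; `hr` places `E z` there.
  have ho : Topology.IsOpenEmbedding F :=
    .of_continuous_injective_isOpenMap
      (continuous_iff_continuousAt.2 fun x => (hF x).continuousAt)
      (strictMono_of_hasDerivAt_pos hF hf).injective
      (isOpenMap_of_hasStrictDerivAt (fun x => hasStrictDerivAt_of_hasDerivAt_of_continuousAt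
        (Eventually.of_forall hF) hfc.continuousAt) fun x => (hf x).ne')
  set e := ho.toOpenPartialHomeomorph F with he
  have hmem : ∀ z, E z ∈ e.target := fun z => by
    rw [he, ho.toOpenPartialHomeomorph_target]
    exact hr z
  refine ⟨fun z => e.symm (E z), fun z => ⟨e.right_inv (hmem z), ?_⟩⟩
  have h := (e.hasDerivAt_symm (hmem z) (hf _).ne' (hF _)).comp z (hE z)
  exact h.congr_deriv (by rw [div_eq_inv_mul])

/-- Every function of type `G` with mass `m` is the image of `m` times the centred gaussian of
type `G` under an expansive transport map. -/
lemma exists_expansive_transport {G : ℝ} (hG : 0 < G) {f : ℝ → ℝ} (hf : f ∈ TypeClass G) :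
    ∃ m : ℝ, 0 < m ∧ ∫⁻ x, ENNReal.ofReal (f x) = ENNReal.ofReal m ∧ Continuous f ∧
      (∀ x, 0 < f x) ∧ ∃ T T' : ℝ → ℝ, ∀ z, HasDerivAt T (T' z) z ∧ 1 ≤ T' z ∧
        f (T z) = m * gauss G z / T' z := by
  obtain ⟨μ, hμf, hμ, rfl⟩ := hf
  have hm : 0 < μ.real Set.univ := by
    rw [measureReal_def]
    exact ENNReal.toReal_pos (Measure.measure_univ_pos.2 hμ).ne' (measure_ne_top _ _)
  have hpos := mixture_pos μ hG hμ
  refine ⟨μ.real Set.univ, hm, lintegral_mixture μ hG, continuous_mixture μ hG, hpos, ?_⟩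
  obtain ⟨T, hT⟩ := exists_transport (hasDerivAt_mixturePrim μ hG) hpos (continuous_mixture μ hG)
    (fun z => (hasDerivAt_gaussPrim G z).const_mul (μ.real Set.univ))
    (exists_mixturePrim_eq μ hG hμ)
  refine ⟨T, _, fun z => ⟨(hT z).2, ?_, ?_⟩⟩
  -- Here `T' z = m * gauss G z / f (T z)`, so expansiveness is exactly `mixture_le`.
  · rw [one_le_div (hpos _)]
    exact mixture_le μ hG (hT z).1
  · have := (gauss_pos hG z).ne'
    have := (hpos (T z)).ne'
    field_simp

/-- The gaussian constant `(σ₁^{c₁} σ₂^{c₂} / (c₁ σ₁ + c₂ σ₂))^{1/2}`. -/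
def gaussConst (c₁ c₂ σ₁ σ₂ : ℝ) : ℝ :=
  (σ₁ ^ c₁ * σ₂ ^ c₂ / (c₁ * σ₁ + c₂ * σ₂)) ^ (1 / 2 : ℝ)

/-! ### Sharpness and the gaussian constant -/

section

variable {c₁ c₂ σ₁ σ₂ : ℝ}

lemma gaussConst_pos (hc₁ : 0 < c₁) (hc₂ : 0 < c₂) (hσ₁ : 0 < σ₁) (hσ₂ : 0 < σ₂) :
    0 < gaussConst c₁ c₂ σ₁ σ₂ := by
  unfold gaussConst
  positivity

lemma Phi_inv_rpow (hc₁ : 0 < c₁) (hc₂ : 0 < c₂) (hσ₁ : 0 < σ₁) (hσ₂ : 0 < σ₂) :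
    Phi c₁ c₂ σ₁⁻¹ σ₂⁻¹ ^ (-(1 / 2) : ℝ) = gaussConst c₁ c₂ σ₁ σ₂ := by
  have h : Phi c₁ c₂ σ₁⁻¹ σ₂⁻¹ = (σ₁ ^ c₁ * σ₂ ^ c₂ / (c₁ * σ₁ + c₂ * σ₂))⁻¹ := by
    unfold Phi
    rw [Real.inv_rpow hσ₁.le, Real.inv_rpow hσ₂.le, div_inv_eq_mul, div_inv_eq_mul, inv_div,
      ← mul_inv, div_eq_inv_mul]
  rw [h, gaussConst, Real.rpow_neg (by positivity), Real.inv_rpow (by positivity), inv_inv]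

lemma gauss_inv_rpow {σ : ℝ} (hσ : 0 < σ) (c x : ℝ) :
    gauss σ⁻¹ x ^ c = (√(σ ^ c))⁻¹ * Real.exp (-Real.pi * (c * x ^ 2 / σ)) := by
  unfold gauss
  rw [Real.mul_rpow (Real.sqrt_nonneg _) (Real.exp_pos _).le, ← Real.exp_mul, Real.sqrt_inv,
    Real.inv_rpow (Real.sqrt_nonneg _), Real.sqrt_eq_rpow, Real.sqrt_eq_rpow,
    ← Real.rpow_mul hσ.le, ← Real.rpow_mul hσ.le, mul_comm c]
  congr 2
  ring

lemma gaussConst_eq (hσ₁ : 0 < σ₁) (hσ₂ : 0 < σ₂) :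
    gaussConst c₁ c₂ σ₁ σ₂ = √(σ₁ ^ c₁) * √(σ₂ ^ c₂) / √(c₁ * σ₁ + c₂ * σ₂) := by
  rw [gaussConst, ← Real.sqrt_eq_rpow, Real.sqrt_div (by positivity),
    Real.sqrt_mul (by positivity)]

/-- The points `xᵢ = σᵢ s` are the equality case of `gauss_rpow_mul_le`, which is why transport runs
along them. -/
lemma gaussConst_mul_gauss (hc₁ : 0 < c₁) (hc₂ : 0 < c₂) (hσ₁ : 0 < σ₁) (hσ₂ : 0 < σ₂) (s : ℝ) :
    gaussConst c₁ c₂ σ₁ σ₂ * ((c₁ * σ₁ + c₂ * σ₂) *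
      (gauss σ₁⁻¹ (σ₁ * s) ^ c₁ * gauss σ₂⁻¹ (σ₂ * s) ^ c₂)) = gauss (c₁ * σ₁ + c₂ * σ₂) s := by
  have hS : 0 < c₁ * σ₁ + c₂ * σ₂ := by positivity
  have hexp : Real.exp (-Real.pi * (c₁ * (σ₁ * s) ^ 2 / σ₁)) *
      Real.exp (-Real.pi * (c₂ * (σ₂ * s) ^ 2 / σ₂)) =
      Real.exp (-Real.pi * ((c₁ * σ₁ + c₂ * σ₂) * s ^ 2)) := by
    rw [← Real.exp_add]
    congr 1
    field_simp
    ring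
  rw [gaussConst_eq hσ₁ hσ₂, gauss_inv_rpow hσ₁, gauss_inv_rpow hσ₂, gauss, ← hexp]
  have h₁ : 0 < √(σ₁ ^ c₁) := Real.sqrt_pos.2 (Real.rpow_pos_of_pos hσ₁ _)
  have h₂ : 0 < √(σ₂ ^ c₂) := Real.sqrt_pos.2 (Real.rpow_pos_of_pos hσ₂ _)
  have h₃ := Real.sqrt_pos.2 hS
  have h₄ := Real.sq_sqrt hS.le
  set D := √(c₁ * σ₁ + c₂ * σ₂)
  rw [← h₄]
  field_simp

lemma weighted_amgm_of_one_le (hc₁ : 0 < c₁) (hc₂ : 0 < c₂) (hσ₁ : 0 < σ₁) (hσ₂ : 0 < σ₂)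
    (h₁ : c₁ * σ₁ + c₂ * σ₂ ≤ σ₁) (h₂ : c₁ * σ₁ + c₂ * σ₂ ≤ σ₂) {t₁ t₂ : ℝ}
    (ht₁ : 1 ≤ t₁) (ht₂ : 1 ≤ t₂) :
    (c₁ * σ₁ + c₂ * σ₂) * (t₁ ^ c₁ * t₂ ^ c₂) ≤ c₁ * σ₁ * t₁ + c₂ * σ₂ * t₂ := by
  set S := c₁ * σ₁ + c₂ * σ₂ with hS
  have hSpos : 0 < S := by positivity
  have hle : ∀ {c σ : ℝ}, 0 < c → S ≤ σ → c ≤ c * σ / S := fun hc h => by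
    rw [le_div_iff₀ hSpos]
    exact mul_le_mul_of_nonneg_left h hc.le
  have hAG := Real.geom_mean_le_arith_mean2_weighted (w₁ := c₁ * σ₁ / S) (w₂ := c₂ * σ₂ / S)
    (p₁ := t₁) (p₂ := t₂) (by positivity) (by positivity) (by linarith) (by linarith)
    (by rw [← add_div, ← hS, div_self hSpos.ne'])
  have hpow : t₁ ^ c₁ * t₂ ^ c₂ ≤ t₁ ^ (c₁ * σ₁ / S) * t₂ ^ (c₂ * σ₂ / S) := by
    have := Real.rpow_le_rpow_of_exponent_le ht₁ (hle hc₁ h₁)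
    have := Real.rpow_le_rpow_of_exponent_le ht₂ (hle hc₂ h₂)
    gcongr
  calc S * (t₁ ^ c₁ * t₂ ^ c₂) ≤ S * (c₁ * σ₁ / S * t₁ + c₂ * σ₂ / S * t₂) := by
        have := hpow.trans hAG
        gcongr
    _ = c₁ * σ₁ * t₁ + c₂ * σ₂ * t₂ := by
        field_simp

/-- A violation would persist on a nonempty open set, which has positive measure. -/
lemma le_essSup_of_continuous {f : ℝ → ENNReal} (hf : Continuous f) (t : ℝ) :
    f t ≤ essSup f volume := by
  by_contra! h
  have hae : ∀ᵐ y, ¬ essSup f volume < f y :=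
    (ENNReal.ae_le_essSup f).mono fun y hy => not_lt.2 hy
  have hopen : IsOpen {y | essSup f volume < f y} := isOpen_lt continuous_const hf
  refine (hopen.measure_pos volume ⟨t, h⟩).ne' ?_
  simpa [ae_iff] using hae

lemma le_supConv (hc₂ : 0 < c₂) {f₁ f₂ : ℝ → ℝ} (hf₁ : Continuous f₁) (hf₂ : Continuous f₂)
    (hp₁ : ∀ x, 0 < f₁ x) (hp₂ : ∀ x, 0 < f₂ x) (x₁ x₂ : ℝ) :
    ENNReal.ofReal (f₁ x₁ ^ c₁ * f₂ x₂ ^ c₂) ≤ supConv c₁ c₂ f₁ f₂ (c₁ * x₁ + c₂ * x₂) := by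
  have hcont : Continuous fun t : ℝ => ENNReal.ofReal
      (f₁ t ^ c₁ * f₂ ((c₁ * x₁ + c₂ * x₂ - c₁ * t) / c₂) ^ c₂) := by
    refine ENNReal.continuous_ofReal.comp (Continuous.mul ?_ ?_)
    · exact hf₁.rpow_const fun t => Or.inl (hp₁ t).ne'
    · exact (hf₂.comp (by fun_prop)).rpow_const fun t => Or.inl (hp₂ _).ne'
  have h := le_essSup_of_continuous hcont x₁
  have hx : (c₁ * x₁ + c₂ * x₂ - c₁ * x₁) / c₂ = x₂ := by field_simp; ring
  simpa only [hx, supConv] using h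

/-- The regularized Prékopa–Leindler inequality, by mass transport from the centred gaussians. -/
lemma isPLConstant_gaussConst (hc₁ : 0 < c₁) (hc₂ : 0 < c₂) (hσ₁ : 0 < σ₁) (hσ₂ : 0 < σ₂)
    (h₁ : c₁ * σ₁ + c₂ * σ₂ ≤ σ₁) (h₂ : c₁ * σ₁ + c₂ * σ₂ ≤ σ₂) :
    IsPLConstant c₁ c₂ σ₁⁻¹ σ₂⁻¹ (ENNReal.ofReal (gaussConst c₁ c₂ σ₁ σ₂)) := by
  intro f₁ hf₁ f₂ hf₂
  obtain ⟨m₁, hm₁, hint₁, hcont₁, hpos₁, T₁, T₁', hT₁⟩ :=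
    exists_expansive_transport (inv_pos.2 hσ₁) hf₁
  obtain ⟨m₂, hm₂, hint₂, hcont₂, hpos₂, T₂, T₂', hT₂⟩ :=
    exists_expansive_transport (inv_pos.2 hσ₂) hf₂
  have hK := gaussConst_pos hc₁ hc₂ hσ₁ hσ₂
  set S := c₁ * σ₁ + c₂ * σ₂ with hS
  have hSpos : 0 < S := by positivity
  set X : ℝ → ℝ := fun s => c₁ * T₁ (σ₁ * s) + c₂ * T₂ (σ₂ * s) with hX
  set X' : ℝ → ℝ := fun s => c₁ * σ₁ * T₁' (σ₁ * s) + c₂ * σ₂ * T₂' (σ₂ * s) with hX'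
  have hone₁ : ∀ z, 1 ≤ T₁' z := fun z => (hT₁ z).2.1
  have hone₂ : ∀ z, 1 ≤ T₂' z := fun z => (hT₂ z).2.1
  have hXpos : ∀ s, 0 < X' s := fun s => by
    have := zero_lt_one.trans_le (hone₁ (σ₁ * s))
    have := zero_lt_one.trans_le (hone₂ (σ₂ * s))
    positivity
  have hXd : ∀ s, HasDerivAt X (X' s) s := fun s => by
    have d : ∀ σ : ℝ, HasDerivAt (fun s : ℝ => σ * s) σ s := fun σ => by
      simpa using (hasDerivAt_id s).const_mul σ
    have d₁ := (((hT₁ (σ₁ * s)).1.comp s (d σ₁)).const_mul c₁)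
    have d₂ := (((hT₂ (σ₂ * s)).1.comp s (d σ₂)).const_mul c₂)
    exact (d₁.add d₂).congr_deriv (by simp only [hX']; ring)
  have hpt : ∀ s, m₁ ^ c₁ * m₂ ^ c₂ * gauss S s ≤ gaussConst c₁ c₂ σ₁ σ₂ *
      (X' s * (f₁ (T₁ (σ₁ * s)) ^ c₁ * f₂ (T₂ (σ₂ * s)) ^ c₂)) := fun s => by
    have ht₁ := hone₁ (σ₁ * s)
    have ht₂ := hone₂ (σ₂ * s)
    have hg₁ := gauss_pos (inv_pos.2 hσ₁) (σ₁ * s)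
    have hg₂ := gauss_pos (inv_pos.2 hσ₂) (σ₂ * s)
    have key := weighted_amgm_of_one_le hc₁ hc₂ hσ₁ hσ₂ h₁ h₂ ht₁ ht₂
    rw [← hS] at key
    rw [(hT₁ (σ₁ * s)).2.2, (hT₂ (σ₂ * s)).2.2, ← gaussConst_mul_gauss hc₁ hc₂ hσ₁ hσ₂ s, ← hS]
    simp only [hX']
    generalize T₁' (σ₁ * s) = t₁ at *
    generalize T₂' (σ₂ * s) = t₂ at *
    generalize gauss σ₁⁻¹ (σ₁ * s) = g₁ at *
    generalize gauss σ₂⁻¹ (σ₂ * s) = g₂ at *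
    have ht₁' : 0 < t₁ := by linarith
    have ht₂' : 0 < t₂ := by linarith
    rw [Real.div_rpow (by positivity) ht₁'.le, Real.div_rpow (by positivity) ht₂'.le,
      Real.mul_rpow hm₁.le hg₁.le, Real.mul_rpow hm₂.le hg₂.le]
    have hq₁ := Real.rpow_pos_of_pos ht₁' c₁
    have hq₂ := Real.rpow_pos_of_pos ht₂' c₂
    -- Multiplying and dividing by `t₁ ^ c₁ * t₂ ^ c₂` isolates the left side of `key`.
    calc m₁ ^ c₁ * m₂ ^ c₂ * (gaussConst c₁ c₂ σ₁ σ₂ * (S * (g₁ ^ c₁ * g₂ ^ c₂)))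
        = gaussConst c₁ c₂ σ₁ σ₂ * ((S * (t₁ ^ c₁ * t₂ ^ c₂)) *
            (m₁ ^ c₁ * g₁ ^ c₁ / t₁ ^ c₁ * (m₂ ^ c₂ * g₂ ^ c₂ / t₂ ^ c₂))) := by
          field_simp
      _ ≤ _ := by gcongr
  have hinj : Function.Injective X := (strictMono_of_hasDerivAt_pos hXd hXpos).injective
  have hgauss : ENNReal.ofReal (m₁ ^ c₁ * m₂ ^ c₂) =
      ∫⁻ s, ENNReal.ofReal (m₁ ^ c₁ * m₂ ^ c₂ * gauss S s) := by
    simp_rw [ENNReal.ofReal_mul (show 0 ≤ m₁ ^ c₁ * m₂ ^ c₂ by positivity)]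
    rw [lintegral_const_mul' _ _ ENNReal.ofReal_ne_top, lintegral_gauss hSpos, mul_one]
  rw [hint₁, hint₂, ENNReal.ofReal_rpow_of_pos hm₁, ENNReal.ofReal_rpow_of_pos hm₂,
    ← ENNReal.ofReal_mul (by positivity), hgauss]
  calc ∫⁻ s, ENNReal.ofReal (m₁ ^ c₁ * m₂ ^ c₂ * gauss S s)
      ≤ ∫⁻ s, ENNReal.ofReal (gaussConst c₁ c₂ σ₁ σ₂) *
          (ENNReal.ofReal |X' s| * supConv c₁ c₂ f₁ f₂ (X s)) := by
        refine lintegral_mono fun s => (ENNReal.ofReal_le_ofReal (hpt s)).trans ?_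
        rw [ENNReal.ofReal_mul hK.le, ENNReal.ofReal_mul (hXpos s).le, abs_of_pos (hXpos s)]
        gcongr
        exact le_supConv hc₂ hcont₁ hcont₂ hpos₁ hpos₂ _ _
    _ = ENNReal.ofReal (gaussConst c₁ c₂ σ₁ σ₂) *
          ∫⁻ x in X '' Set.univ, supConv c₁ c₂ f₁ f₂ x := by
        rw [lintegral_const_mul' _ _ ENNReal.ofReal_ne_top,
          lintegral_image_eq_lintegral_abs_deriv_mul MeasurableSet.univ
            (fun s _ => (hXd s).hasDerivWithinAt) hinj.injOn, Measure.restrict_univ]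
    _ ≤ _ := by
        -- Surjectivity of `X` is not needed: enlarging the domain only increases the integral.
        gcongr
        exact Measure.restrict_le_self

/-- Every centred gaussian of larger variance is of type `σ⁻¹`. -/
lemma gauss_mem_typeClass {σ τ : ℝ} (hσ : 0 < σ) (hτ : σ ≤ τ) :
    gauss τ⁻¹ ∈ TypeClass σ⁻¹ := by
  rcases hτ.eq_or_lt with rfl | hlt
  · exact ⟨Measure.dirac 0, inferInstance, Measure.dirac_ne_zero, by simp⟩
  have hτ' : 0 < τ := hσ.trans hlt
  -- Variances add under convolution, so the mixing measure is the gaussian of variance `τ - σ`;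
  -- `hsplit` completes the square in `y`.
  set δ := τ - σ with hδ
  have hδ' : 0 < δ := sub_pos.2 hlt
  have hb : 0 < δ⁻¹ := inv_pos.2 hδ'
  have hmeas : Measurable fun y => ENNReal.ofReal (gauss δ⁻¹ y) :=
    (ENNReal.continuous_ofReal.comp (continuous_gauss _)).measurable
  refine ⟨volume.withDensity fun y => ENNReal.ofReal (gauss δ⁻¹ y),
    isFiniteMeasure_withDensity_ofReal (integrable_gauss hb).hasFiniteIntegral, fun h => ?_, ?_⟩
  · have := congrArg (fun μ : Measure ℝ => μ Set.univ) h
    simp [lintegral_gauss hb] at this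
  funext x
  have hG : 0 < τ / (σ * δ) := by positivity
  have hsplit : ∀ y, gauss δ⁻¹ y * gauss σ⁻¹ (x - y) =
      gauss τ⁻¹ x * gauss (τ / (σ * δ)) (y - δ / τ * x) := fun y => by
    have hs : √δ⁻¹ * √σ⁻¹ = √τ⁻¹ * √(τ / (σ * δ)) := by
      rw [← Real.sqrt_mul hb.le, ← Real.sqrt_mul (inv_pos.2 hτ').le]
      congr 1
      field_simp
    have he : -Real.pi * (δ⁻¹ * y ^ 2) + -Real.pi * (σ⁻¹ * (x - y) ^ 2) =
        -Real.pi * (τ⁻¹ * x ^ 2) + -Real.pi * (τ / (σ * δ) * (y - δ / τ * x) ^ 2) := by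
      have hτe : τ = σ + δ := by simp [hδ]
      clear_value δ
      subst hτe
      field_simp
      ring
    unfold gauss
    rw [mul_mul_mul_comm, hs, ← Real.exp_add, he, Real.exp_add, mul_mul_mul_comm]
  rw [integral_withDensity_eq_integral_toReal_smul hmeas
    (Eventually.of_forall fun y => ENNReal.ofReal_lt_top)]
  simp_rw [ENNReal.toReal_ofReal (gauss_pos hb _).le, smul_eq_mul, hsplit]
  rw [integral_const_mul, integral_sub_right_eq_self (gauss (τ / (σ * δ))), integral_gauss hG,
    mul_one]

/-- Cauchy–Schwarz for the exponents, with defect a multiple of `(x₁σ₂ - x₂σ₁)²`. -/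
lemma gauss_rpow_mul_le (hc₁ : 0 < c₁) (hc₂ : 0 < c₂) (hσ₁ : 0 < σ₁) (hσ₂ : 0 < σ₂) (x₁ x₂ : ℝ) :
    gauss σ₁⁻¹ x₁ ^ c₁ * gauss σ₂⁻¹ x₂ ^ c₂ ≤
      (gaussConst c₁ c₂ σ₁ σ₂)⁻¹ * gauss (c₁ * σ₁ + c₂ * σ₂)⁻¹ (c₁ * x₁ + c₂ * x₂) := by
  have hS : 0 < c₁ * σ₁ + c₂ * σ₂ := by positivity
  have hq : (c₁ * σ₁ + c₂ * σ₂)⁻¹ * (c₁ * x₁ + c₂ * x₂) ^ 2 ≤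
      c₁ * x₁ ^ 2 / σ₁ + c₂ * x₂ ^ 2 / σ₂ := by
    rw [inv_mul_le_iff₀ hS]
    have : (c₁ * σ₁ + c₂ * σ₂) * (c₁ * x₁ ^ 2 / σ₁ + c₂ * x₂ ^ 2 / σ₂) - (c₁ * x₁ + c₂ * x₂) ^ 2 =
        c₁ * c₂ * (x₁ * σ₂ - x₂ * σ₁) ^ 2 / (σ₁ * σ₂) := by
      field_simp
      ring
    have : 0 ≤ c₁ * c₂ * (x₁ * σ₂ - x₂ * σ₁) ^ 2 / (σ₁ * σ₂) := by positivity
    linarith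
  have h₁ : 0 < √(σ₁ ^ c₁) := Real.sqrt_pos.2 (Real.rpow_pos_of_pos hσ₁ _)
  have h₂ : 0 < √(σ₂ ^ c₂) := Real.sqrt_pos.2 (Real.rpow_pos_of_pos hσ₂ _)
  have h₃ := Real.sqrt_pos.2 hS
  rw [gauss_inv_rpow hσ₁, gauss_inv_rpow hσ₂, gaussConst_eq hσ₁ hσ₂, gauss,
    mul_mul_mul_comm, ← Real.exp_add, ← mul_assoc, Real.sqrt_inv]
  have hconst : (√(σ₁ ^ c₁) * √(σ₂ ^ c₂) / √(c₁ * σ₁ + c₂ * σ₂))⁻¹ * (√(c₁ * σ₁ + c₂ * σ₂))⁻¹ =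
      (√(σ₁ ^ c₁))⁻¹ * (√(σ₂ ^ c₂))⁻¹ := by
    field_simp
  rw [hconst]
  gcongr
  have := mul_le_mul_of_nonneg_left hq Real.pi_pos.le
  linarith

/-- Testing on centred gaussians of larger variances. -/
lemma gaussConst_le_of_isPLConstant {τ₁ τ₂ : ℝ} (hc₁ : 0 < c₁) (hc₂ : 0 < c₂) (hσ₁ : 0 < σ₁)
    (hσ₂ : 0 < σ₂) (hτ₁ : σ₁ ≤ τ₁) (hτ₂ : σ₂ ≤ τ₂) {C : ENNReal}
    (hC : IsPLConstant c₁ c₂ σ₁⁻¹ σ₂⁻¹ C) :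
    ENNReal.ofReal (gaussConst c₁ c₂ τ₁ τ₂) ≤ C := by
  have hp₁ : 0 < τ₁ := hσ₁.trans_le hτ₁
  have hp₂ : 0 < τ₂ := hσ₂.trans_le hτ₂
  have hS : 0 < c₁ * τ₁ + c₂ * τ₂ := by positivity
  have hK := gaussConst_pos hc₁ hc₂ hp₁ hp₂
  have h := hC _ (gauss_mem_typeClass hσ₁ hτ₁) _ (gauss_mem_typeClass hσ₂ hτ₂)
  rw [lintegral_gauss (inv_pos.2 hp₁), lintegral_gauss (inv_pos.2 hp₂), ENNReal.one_rpow,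
    ENNReal.one_rpow, one_mul] at h
  have hle : ∫⁻ x, supConv c₁ c₂ (gauss τ₁⁻¹) (gauss τ₂⁻¹) x ≤
      ENNReal.ofReal (gaussConst c₁ c₂ τ₁ τ₂)⁻¹ := by
    calc ∫⁻ x, supConv c₁ c₂ (gauss τ₁⁻¹) (gauss τ₂⁻¹) x
        ≤ ∫⁻ x, ENNReal.ofReal (gaussConst c₁ c₂ τ₁ τ₂)⁻¹ *
            ENNReal.ofReal (gauss (c₁ * τ₁ + c₂ * τ₂)⁻¹ x) := by
          refine lintegral_mono fun x => essSup_le_of_ae_le _ (Eventually.of_forall fun t => ?_)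
          rw [← ENNReal.ofReal_mul (inv_pos.2 hK).le]
          refine ENNReal.ofReal_le_ofReal
            ((gauss_rpow_mul_le hc₁ hc₂ hp₁ hp₂ t ((x - c₁ * t) / c₂)).trans_eq ?_)
          congr 2
          field_simp
          ring
      _ = _ := by
          rw [lintegral_const_mul' _ _ ENNReal.ofReal_ne_top, lintegral_gauss (inv_pos.2 hS),
            mul_one]
  have h' := h.trans (mul_le_mul_right hle C)
  rw [ENNReal.ofReal_inv_of_pos hK, ← div_eq_mul_inv] at h'
  rwa [ENNReal.le_div_iff_mul_le (Or.inl (ENNReal.ofReal_pos.2 hK).ne')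
    (Or.inl ENNReal.ofReal_ne_top), one_mul] at h'

/-- Both sides of `h` agree at `r = 1`, so the conclusion compares their derivatives there. The
bound `r ^ c₁ ≥ 1 + c₁(1 - r⁻¹)` replaces differentiation. -/
lemma le_of_forall_rpow_le (hc₁ : 0 < c₁) (hσ₁ : 0 < σ₁) {b : ℝ} (hS : 0 < c₁ * σ₁ + b)
    (h : ∀ r, 1 < r → (c₁ * σ₁ + b) * r ^ c₁ ≤ c₁ * (r * σ₁) + b) :
    c₁ * σ₁ + b ≤ σ₁ := by
  have key : ∀ r : ℝ, 1 < r → c₁ * σ₁ + b ≤ r * σ₁ := fun r hr => by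
    have hr0 : 0 < r := by linarith
    have hlog : 1 + c₁ * (1 - r⁻¹) ≤ r ^ c₁ := by
      rw [Real.rpow_def_of_pos hr0]
      have h₁ := Real.one_sub_inv_le_log_of_pos hr0
      have h₂ := Real.add_one_le_exp (Real.log r * c₁)
      have h₃ := mul_le_mul_of_nonneg_left h₁ hc₁.le
      linarith
    have h₁ := (mul_le_mul_of_nonneg_left hlog hS.le).trans (h r hr)
    have h₂ : (c₁ * σ₁ + b) * (c₁ * (1 - r⁻¹)) ≤ c₁ * σ₁ * (r - 1) := by linarith
    have h₃ : 1 - r⁻¹ = (r - 1) / r := by field_simp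
    have h₄ : 0 < c₁ * (r - 1) := mul_pos hc₁ (by linarith)
    rw [h₃, ← mul_div_assoc, ← mul_div_assoc, div_le_iff₀ hr0] at h₂
    refine le_of_mul_le_mul_right ?_ h₄
    linarith
  by_contra! hlt
  -- This `r` makes `r * σ₁` the midpoint of `σ₁` and `c₁ * σ₁ + b`.
  have h₁ := key ((c₁ * σ₁ + b + σ₁) / (2 * σ₁)) (by rw [lt_div_iff₀ (by positivity)]; linarith)
  have h₂ : (c₁ * σ₁ + b + σ₁) / (2 * σ₁) * σ₁ = (c₁ * σ₁ + b + σ₁) / 2 := by field_simp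
  linarith

lemma gaussConst_comm (c₁ c₂ σ₁ σ₂ : ℝ) :
    gaussConst c₁ c₂ σ₁ σ₂ = gaussConst c₂ c₁ σ₂ σ₁ := by
  unfold gaussConst
  rw [mul_comm (σ₁ ^ c₁), add_comm]

lemma add_le_of_gaussConst_le (hc₁ : 0 < c₁) (hc₂ : 0 < c₂) (hσ₁ : 0 < σ₁) (hσ₂ : 0 < σ₂)
    (h : ∀ τ, σ₁ ≤ τ → gaussConst c₁ c₂ τ σ₂ ≤ gaussConst c₁ c₂ σ₁ σ₂) :
    c₁ * σ₁ + c₂ * σ₂ ≤ σ₁ := by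
  have hS : 0 < c₁ * σ₁ + c₂ * σ₂ := by positivity
  refine le_of_forall_rpow_le hc₁ hσ₁ hS fun r hr => ?_
  have hr0 : 0 < r := by linarith
  have h₁ := h (r * σ₁) (le_mul_of_one_le_left hσ₁.le hr.le)
  unfold gaussConst at h₁
  rw [Real.rpow_le_rpow_iff (by positivity) (by positivity) (by norm_num),
    div_le_div_iff₀ (by positivity) hS, Real.mul_rpow hr0.le hσ₁.le] at h₁
  have h₂ : 0 < σ₁ ^ c₁ * σ₂ ^ c₂ := by positivity
  refine le_of_mul_le_mul_left ?_ h₂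
  linarith

end

end RegPL

end

theorem mainTheorem7 (c₁ c₂ σ₁ σ₂ : ℝ)
    (hc₁ : c₁ ∈ Set.Ioo (0 : ℝ) 1) (hc₂ : c₂ ∈ Set.Ioo (0 : ℝ) 1) (hc : c₁ + c₂ < 1)
    (hσ₁ : 0 < σ₁) (hσ₂ : 0 < σ₂) :
    RegPL.Phi c₁ c₂ σ₁⁻¹ σ₂⁻¹ ^ (-(1 / 2) : ℝ)
        = (σ₁ ^ c₁ * σ₂ ^ c₂ / (c₁ * σ₁ + c₂ * σ₂)) ^ (1 / 2 : ℝ) ∧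
      (RegPL.PL c₁ c₂ σ₁⁻¹ σ₂⁻¹
          = ENNReal.ofReal ((σ₁ ^ c₁ * σ₂ ^ c₂ / (c₁ * σ₁ + c₂ * σ₂)) ^ (1 / 2 : ℝ)) ↔
        c₁ * σ₁ + c₂ * σ₂ ≤ min σ₁ σ₂) := by
  refine ⟨RegPL.Phi_inv_rpow hc₁.1 hc₂.1 hσ₁ hσ₂, ?_⟩
  change RegPL.PL c₁ c₂ σ₁⁻¹ σ₂⁻¹ = ENNReal.ofReal (RegPL.gaussConst c₁ c₂ σ₁ σ₂) ↔ _
  have hlower : ∀ τ₁ τ₂, σ₁ ≤ τ₁ → σ₂ ≤ τ₂ →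
      ENNReal.ofReal (RegPL.gaussConst c₁ c₂ τ₁ τ₂) ≤ RegPL.PL c₁ c₂ σ₁⁻¹ σ₂⁻¹ :=
    fun τ₁ τ₂ h₁ h₂ => le_sInf fun C hC =>
      RegPL.gaussConst_le_of_isPLConstant hc₁.1 hc₂.1 hσ₁ hσ₂ h₁ h₂ hC
  constructor
  · intro h
    rw [h] at hlower
    have hle : ∀ τ₁ τ₂, σ₁ ≤ τ₁ → σ₂ ≤ τ₂ →
        RegPL.gaussConst c₁ c₂ τ₁ τ₂ ≤ RegPL.gaussConst c₁ c₂ σ₁ σ₂ := fun τ₁ τ₂ h₁ h₂ =>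
      (ENNReal.ofReal_le_ofReal_iff (RegPL.gaussConst_pos hc₁.1 hc₂.1 hσ₁ hσ₂).le).1
        (hlower τ₁ τ₂ h₁ h₂)
    refine le_min ?_ ?_
    · exact RegPL.add_le_of_gaussConst_le hc₁.1 hc₂.1 hσ₁ hσ₂ fun τ hτ => hle τ σ₂ hτ le_rfl
    · rw [add_comm]
      refine RegPL.add_le_of_gaussConst_le hc₂.1 hc₁.1 hσ₂ hσ₁ fun τ hτ => ?_
      rw [RegPL.gaussConst_comm c₂, RegPL.gaussConst_comm c₂]
      exact hle σ₁ τ le_rfl hτ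
  · intro h
    exact le_antisymm
      (sInf_le (RegPL.isPLConstant_gaussConst hc₁.1 hc₂.1 hσ₁ hσ₂
        (h.trans (min_le_left _ _)) (h.trans (min_le_right _ _))))
      (hlower σ₁ σ₂ le_rfl le_rfl)
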